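/- **Setting.** Let $S$ be a finite set of points in the Euclidean plane, no three of them collinear. A geometric graph on $S$ is a simple graph with vertex set $S$ whose edges are drawn as closed segments; it is *non-crossing* if two distinct edges meet only in a common endpoint. A *perfect matching* of $S$ is a non-crossing geometric graph on $S$ in which every vertex has degree exactly one; it is *even* if its number of edges is even. Two non-crossing geometric graphs on $S$ are *compatible* if their union is non-crossing, and *disjoint* if they have no common edge. An *extension* $L$ of a perfect matching $M$ is obtained by taking the segments of $M$ in some order and extending each in both directions by rays, each ray being continued until it hits another segment of $M$ or a previous extension (or to infinity). The cells of $L$ are the connected components of the complement of the union of the extended segments. The *dual multigraph* $G$ has the cells as vertices and, for every vertex $v$ of $M$, one edge (also called $v$) joining the two cells that have $v$ on their boundary. An *even orientation* of a multigraph is an orientation in which all indegrees are even; a multigraph is *even* if it has an even number of edges. An *edge-partition* of $G$ into two subgraphs consists of two subgraphs with disjoint edge sets whose union is $E(G)$. For a perfect matching $M$ consider the properties: * (TT) $M$ has an extension whose dual multigraph has an edge-partition into two trees such that, for every segment $vw$ of $M$, the edges $v$ and $w$ are in different trees. * (TS) $M$ has an extension whose dual multigraph has an edge-partition into two subgraphs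 $G_1,G_2$ such that every connected component of $G_1$ and of $G_2$ is even and, for every segment $vw$ of $M$, the edges $v$ and $w$ are in different subgraphs. * (E) $M$ has an extension whose dual multigraph has an even orientation such that, whenever a cell has indegree $2$, its two incoming edges do not arise from the two endpoints of the same segment of $M$. * (CM) There is a perfect matching of the same vertex set that is disjoint from and compatible with $M$. The *Two Trees Conjecture* says that every (even or odd) perfect matching satisfies (TT). The *Two Subgraphs Conjecture*, the *Extension Conjecture* and the *Compatible Matching Conjecture* say that every even perfect matching satisfies (TS), (E) and (CM), respectively. **Theorem.** The Two Trees Conjecture implies the Two Subgraphs Conjecture, which implies the Extension Conjecture, which implies the Compatible Matching Conjecture. Moreover, the implications hold for each matching separately: every even perfect matching that satisfies (TT) satisfies (TS), every perfect matching that satisfies (TS) satisfies (E), and every perfect matching that satisfies (E) satisfies (CM). -/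

import Mathlib

namespace CompatibleMatchings

/-! ### Multigraphs

Multigraphs are Mathlib's `Graph α β` (vertices in `α`, edges in `β`, parallel edges allowed);
`H ≤ G` means that `H` is a subgraph of `G`. -/

section Multigraph

variable {α β : Type*}

/-- A multigraph is connected if it has a vertex and any two vertices are joined by a walk. -/
def IsConnected (G : Graph α β) : Prop :=
  G.vertexSet.Nonempty ∧
    ∀ x ∈ G.vertexSet, ∀ y ∈ G.vertexSet, Relation.ReflTransGen G.Adj x y

/-- A multigraph is acyclic if no edge lies on a cycle, that is, after the deletion of an edge its
two ends are no longer joined by a walk.  Loops and pairs of parallel edges are cycles. -/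
def IsAcyclic (G : Graph α β) : Prop :=
  ∀ e x y, G.IsLink e x y →
    ¬ Relation.ReflTransGen (fun a b => ∃ f, f ≠ e ∧ G.IsLink f a b) x y

/-- A tree is a connected acyclic multigraph. -/
def IsTree (G : Graph α β) : Prop := IsConnected G ∧ IsAcyclic G

/-- A multigraph is even if it has an even number of edges. -/
def IsEvenMultigraph (G : Graph α β) : Prop := Even G.edgeSet.ncard

/-- `C` is a connected component of `G`: a connected subgraph of `G` containing every edge of `G`
that is incident with one of its vertices. -/
def IsComponent (C G : Graph α β) : Prop := C.IsClosedSubgraph G ∧ IsConnected C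

/-- The subgraphs `G₁` and `G₂` form an edge-partition of `G`. -/
structure IsEdgePartition (G G₁ G₂ : Graph α β) : Prop where
  left_le : G₁ ≤ G
  right_le : G₂ ≤ G
  disjoint : Disjoint G₁.edgeSet G₂.edgeSet
  union_eq : G₁.edgeSet ∪ G₂.edgeSet = G.edgeSet

/-- An orientation of `G`, given by choosing for each edge `e` one of its ends, `head e`,
as the vertex that `e` enters.  (Only the values on edges of `G` matter.) -/
def IsOrientation (G : Graph α β) (head : β → α) : Prop :=
  ∀ e ∈ G.edgeSet, G.Inc e (head e)

/-- The edges entering the vertex `x`; their number is the indegree of `x`. -/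
def incoming (G : Graph α β) (head : β → α) (x : α) : Set β :=
  {e | e ∈ G.edgeSet ∧ head e = x}

/-- An even orientation: every vertex has even indegree. -/
def IsEvenOrientation (G : Graph α β) (head : β → α) : Prop :=
  IsOrientation G head ∧ ∀ x ∈ G.vertexSet, Even (incoming G head x).ncard

end Multigraph

/-! ### Geometric graphs and matchings

A geometric graph with vertex set `S`, a finite set of points of the plane in general position,
is a `SimpleGraph S`; the edge `vw` is the closed segment with endpoints `v` and `w`. -/

/-- The Euclidean plane. -/
abbrev Plane : Type := EuclideanSpace ℝ (Fin 2)

/-- No three distinct points of `S` are collinear. -/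
def GeneralPosition (S : Finset Plane) : Prop :=
  ∀ a ∈ S, ∀ b ∈ S, ∀ c ∈ S, a ≠ b → a ≠ c → b ≠ c → ¬ Collinear ℝ {a, b, c}

variable {S : Finset Plane}

/-- Two distinct edges meet at most in a common endpoint. -/
def NonCrossing (M : SimpleGraph S) : Prop :=
  ∀ a b c d : S, M.Adj a b → M.Adj c d → s(a, b) ≠ s(c, d) →
    segment ℝ (a : Plane) b ∩ segment ℝ (c : Plane) d ⊆ ({(a : Plane), ↑b} ∩ {(c : Plane), ↑d})

/-- A perfect matching of `S`: a non-crossing geometric graph on `S` in which every vertex has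
degree exactly one. -/
def IsPerfectMatching (M : SimpleGraph S) : Prop :=
  NonCrossing M ∧ ∀ v, ∃! w, M.Adj v w

/-- A matching is even if its number of edges is even. -/
def IsEvenMatching (M : SimpleGraph S) : Prop := Even M.edgeSet.ncard

/-- Two non-crossing geometric graphs on the same vertex set are compatible if their union is
non-crossing. -/
def Compatible (M M' : SimpleGraph S) : Prop :=
  NonCrossing M ∧ NonCrossing M' ∧ NonCrossing (M ⊔ M')

/-! ### Extensions and the dual multigraph -/

/-- The union of the segments of `M`. -/
def segmentUnion (M : SimpleGraph S) : Set Plane :=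
  {p | ∃ v w : S, M.Adj v w ∧ p ∈ segment ℝ (v : Plane) w}

/-- The ray that extends the segment `wv` beyond its endpoint `v`, up to and including its first
point (after `v`) in the obstacle `D`; the whole ray if it never meets `D` again. -/
def blockedRay (D : Set Plane) (v w : Plane) : Set Plane :=
  {p | ∃ t : ℝ, 0 ≤ t ∧ (∀ u, 0 < u → u < t → v + u • (v - w) ∉ D) ∧ p = v + t • (v - w)}

/-- Extend the segment `e` in both directions until blocked by `D`, and add the result to `D`. -/
def extendSegment (D : Set Plane) (e : Sym2 S) : Set Plane :=
  D ∪ {p | ∃ v w : S, e = s(v, w) ∧ p ∈ blockedRay D v w}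

/-- `L` is (the union of the extended segments of) an extension of `M`: for some order on the
segments of `M`, the segments are successively extended in both directions, each ray being stopped
by the first segment of `M` or previous extension that it hits. -/
def IsExtension (M : SimpleGraph S) (L : Set Plane) : Prop :=
  ∃ order : List (Sym2 S), order.Nodup ∧ (∀ e, e ∈ order ↔ e ∈ M.edgeSet) ∧
    L = order.foldl extendSegment (segmentUnion M)

/-- The cells of the subdivision of the plane formed by `L`: the connected components of the
complement of `L`. -/
def cells (L : Set Plane) : Set (Set Plane) :=
  {C | ∃ x, x ∉ L ∧ C = connectedComponentIn Lᶜ x}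

/-- The dual multigraph: its vertices are the cells, and each `v ∈ S` that lies on the boundary
of exactly two cells is an edge between these two cells. -/
def dualMultigraph (S : Finset Plane) (L : Set Plane) : Graph (Set Plane) S where
  vertexSet := cells L
  IsLink v C D := C ≠ D ∧ {X | X ∈ cells L ∧ (v : Plane) ∈ frontier X} = {C, D}
  isLink_symm := fun _ _ => ⟨fun C D h => ⟨h.1.symm, by rw [h.2, Set.pair_comm]⟩⟩
  eq_or_eq_of_isLink_of_isLink := by
    intro e x y v w h h'
    have hx : x ∈ ({v, w} : Set (Set Plane)) := by
      rw [← h'.2, h.2]; exact Set.mem_insert _ _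
    simpa using hx
  left_mem_of_isLink := by
    intro e x y h
    have hx : x ∈ ({x, y} : Set (Set Plane)) := Set.mem_insert _ _
    rw [← h.2] at hx
    exact hx.1

/-! ### The properties of a single matching that the conjectures are about -/

/-- There is a perfect matching that is disjoint and compatible with `M`. -/
def HasDisjointCompatibleMatching (M : SimpleGraph S) : Prop :=
  ∃ M' : SimpleGraph S, IsPerfectMatching M' ∧ Disjoint M.edgeSet M'.edgeSet ∧ Compatible M M'

/-- `M` has an extension whose dual multigraph admits an even orientation such that, whenever a
cell has indegree `2`, its two incoming edges do not arise from the same segment of `M`. -/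
def HasEvenlyOrientedExtension (M : SimpleGraph S) : Prop :=
  ∃ L, IsExtension M L ∧ ∃ head : S → Set Plane,
    IsEvenOrientation (dualMultigraph S L) head ∧
    ∀ C ∈ (dualMultigraph S L).vertexSet, (incoming (dualMultigraph S L) head C).ncard = 2 →
      ∀ v ∈ incoming (dualMultigraph S L) head C, ∀ w ∈ incoming (dualMultigraph S L) head C,
        ¬ M.Adj v w

/-- For every segment `vw` of `M`, the edges `v` and `w` lie in different ones of `G₁`, `G₂`. -/
def SeparatesSegments (M : SimpleGraph S) (G₁ G₂ : Graph (Set Plane) S) : Prop :=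
  ∀ v w : S, M.Adj v w →
    (v ∈ G₁.edgeSet ∧ w ∈ G₂.edgeSet) ∨ (v ∈ G₂.edgeSet ∧ w ∈ G₁.edgeSet)

/-- `M` has an extension whose dual multigraph has an edge-partition into two subgraphs all of
whose components are even, with the two edges of every segment in different subgraphs. -/
def HasTwoSubgraphsExtension (M : SimpleGraph S) : Prop :=
  ∃ L, IsExtension M L ∧ ∃ G₁ G₂, IsEdgePartition (dualMultigraph S L) G₁ G₂ ∧
    (∀ C, IsComponent C G₁ → IsEvenMultigraph C) ∧
    (∀ C, IsComponent C G₂ → IsEvenMultigraph C) ∧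
    SeparatesSegments M G₁ G₂

/-- `M` has an extension whose dual multigraph has an edge-partition into two trees, with the two
edges of every segment in different trees. -/
def HasTwoTreesExtension (M : SimpleGraph S) : Prop :=
  ∃ L, IsExtension M L ∧ ∃ T₁ T₂, IsEdgePartition (dualMultigraph S L) T₁ T₂ ∧
    IsTree T₁ ∧ IsTree T₂ ∧ SeparatesSegments M T₁ T₂

/-! ### The conjectures -/

/-- For every even perfect matching there is a disjoint compatible perfect matching. -/
def CompatibleMatchingConjecture : Prop :=
  ∀ (S : Finset Plane) (M : SimpleGraph S), GeneralPosition S → IsPerfectMatching M →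
    IsEvenMatching M → HasDisjointCompatibleMatching M

/-- Every even perfect matching has an extension with a suitable even orientation. -/
def ExtensionConjecture : Prop :=
  ∀ (S : Finset Plane) (M : SimpleGraph S), GeneralPosition S → IsPerfectMatching M →
    IsEvenMatching M → HasEvenlyOrientedExtension M

/-- Every even perfect matching has an extension with a partition into two subgraphs with even
components. -/
def TwoSubgraphsConjecture : Prop :=
  ∀ (S : Finset Plane) (M : SimpleGraph S), GeneralPosition S → IsPerfectMatching M →
    IsEvenMatching M → HasTwoSubgraphsExtension M

/-- Every perfect matching, even or odd, has an extension with a partition into two trees. -/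
def TwoTreesConjecture : Prop :=
  ∀ (S : Finset Plane) (M : SimpleGraph S), GeneralPosition S → IsPerfectMatching M →
    HasTwoTreesExtension M

end CompatibleMatchings

namespace CompatibleMatchings

open Filter Topology

/-! ### Even orientations of multigraphs -/

section EvenOrientations

variable {α β : Type*}

/-! From (TT) to (TS) is counting: each tree is connected and holds exactly one endpoint of every
segment, so it has as many edges as `M`, an even number.

From (TS) to (E): a multigraph with even components has an even orientation
(`exists_isEvenOrientation`), because odd vertices come in pairs within a component and reversing a
connecting walk repairs such a pair. Orienting the two parts separately makes every indegree a sum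
of two even numbers. If the sum is 2, both edges come from the same part, hence not from one
segment.

From (E) to (CM): cells of an extension are convex (`convex_connectedComponentIn_compl`), since
every point of `L` is the midpoint of a segment in `L`, so a cell has no reflex corner. Each point
of `S` lies on the boundary of exactly two cells (`exists_cells_eq_pair`), and the orientation
assigns it to one of them, an even number of points per cell. The points of each cell are paired at
minimal cost, the cost being length plus a large penalty for segments of `M`
(`exists_optimal_involution`). The indegree condition and optimality exclude segments of `M` and
crossings within a cell. By convexity the new segments run inside their cells, so they cross neither
`M` nor segments of other cells. -/

lemma IsComponent.edgeSet_eq_of_isConnected {C G : Graph α β} (hC : IsComponent C G)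
    (hG : IsConnected G) : C.edgeSet = G.edgeSet := by
  obtain ⟨hcl, ⟨c, hc⟩, -⟩ := hC
  refine Set.Subset.antisymm (hcl.le.edgeSet_mono) fun e he => ?_
  obtain ⟨x, y, hxy⟩ := Graph.exists_isLink_of_mem_edgeSet he
  have hreach := hG.2 c (hcl.le.vertexSet_mono hc) x hxy.left_mem
  have hx : x ∈ C.vertexSet := by
    clear hxy
    induction hreach with
    | refl => exact hc
    | tail _ h ih =>
      obtain ⟨f, hf⟩ := h
      have hfC := hcl.closed hf.inc_left ih
      exact ((hcl.le.isLink_iff hfC).2 hf).right_mem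
  exact hcl.closed hxy.inc_left hx

/-- The component of the vertex `x`. -/
def componentOf (G : Graph α β) (x : α) : Graph α β where
  vertexSet := {y | Relation.ReflTransGen G.Adj x y ∧ y ∈ G.vertexSet}
  IsLink e a b := G.IsLink e a b ∧ Relation.ReflTransGen G.Adj x a
  isLink_symm := fun _ _ => ⟨fun _ _ h => ⟨h.1.symm, h.2.tail ⟨_, h.1⟩⟩⟩
  eq_or_eq_of_isLink_of_isLink := fun _ _ _ _ _ h h' => h.1.left_eq_or_eq h'.1
  left_mem_of_isLink := fun _ _ _ h => ⟨h.2, h.1.left_mem⟩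

lemma reflTransGen_componentOf {G : Graph α β} {x y : α} (h : Relation.ReflTransGen G.Adj x y) :
    Relation.ReflTransGen (componentOf G x).Adj x y := by
  induction h with
  | refl => exact .refl
  | tail h₁ h₂ ih =>
    obtain ⟨e, he⟩ := h₂
    exact ih.tail ⟨e, he, h₁⟩

lemma isComponent_componentOf {G : Graph α β} {x : α} (hx : x ∈ G.vertexSet) :
    IsComponent (componentOf G x) G := by
  refine ⟨Graph.IsClosedSubgraph.mk' ⟨fun y hy => hy.2, fun e a b h => h.1⟩ ?_,
    ⟨x, .refl, hx⟩, fun y hy z hz => ?_⟩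
  · rintro e a ⟨b, hab⟩ ha
    exact ⟨a, b, hab, ha.1⟩
  · have hsymm : Std.Symm (componentOf G x).Adj := ⟨fun _ _ h => h.symm⟩
    exact (Relation.ReflTransGen.stdSymm.symm _ _
      (reflTransGen_componentOf hy.1)).trans (reflTransGen_componentOf hz.1)

open Classical in
/-- Reversing edges along a walk from `x` to `y` changes the parity of the indegree at `x` and at
`y` only. -/
lemma IsOrientation.exists_flip_walk [Finite β] {G : Graph α β} {head : β → α}
    (h : IsOrientation G head) {x y : α} (hxy : Relation.ReflTransGen G.Adj x y) :
    ∃ head', IsOrientation G head' ∧ ∀ z, ((incoming G head' z).ncard : ZMod 2) =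
      (incoming G head z).ncard + (if z = x then 1 else 0) + (if z = y then 1 else 0) := by
  -- Moving the head of one edge from `b` to `c` toggles the parity at both; for `b = c` the two
  -- toggles cancel.
  have hflip : ∀ (hd : β → α) (e : β) (b c : α), e ∈ G.edgeSet → hd e = b → ∀ z,
      ((incoming G (Function.update hd e c) z).ncard : ZMod 2) =
      (incoming G hd z).ncard + (if z = b then 1 else 0) + (if z = c then 1 else 0) := by
    intro hd e b c he hb z
    have key : ∀ hd : β → α, ((incoming G hd z).ncard : ZMod 2) =
        ({f | f ≠ e ∧ f ∈ G.edgeSet ∧ hd f = z} : Set β).ncard + (if z = hd e then 1 else 0) := by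
      intro hd
      by_cases hz : z = hd e
      · have : incoming G hd z = insert e {f | f ≠ e ∧ f ∈ G.edgeSet ∧ hd f = z} := by
          ext f
          by_cases hf : f = e
          · subst hf; simp [incoming, he, hz]
          · simp [incoming, hf]
        rw [this, Set.ncard_insert_of_notMem (by simp) (Set.toFinite _)]
        simp [hz]
      · have : incoming G hd z = {f | f ≠ e ∧ f ∈ G.edgeSet ∧ hd f = z} := by
          ext f
          by_cases hf : f = e
          · subst hf; simp [incoming, Ne.symm hz]
          · simp [incoming, hf]
        rw [this]
        simp [hz]
    rw [key, key hd]
    have : ({f | f ≠ e ∧ f ∈ G.edgeSet ∧ Function.update hd e c f = z} : Set β) =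
        {f | f ≠ e ∧ f ∈ G.edgeSet ∧ hd f = z} := by
      ext f
      refine and_congr_right fun hf => ?_
      rw [Function.update_of_ne hf]
    rw [this, Function.update_self, hb]
    have two : ∀ p q r : ZMod 2, p + r = p + q + q + r := by decide
    exact two _ _ _
  induction hxy with
  | refl => exact ⟨head, h, fun z => by rw [add_assoc, CharTwo.add_self_eq_zero, add_zero]⟩
  | @tail b c _ hbc ih =>
    obtain ⟨hd, hor, hpar⟩ := ih
    obtain ⟨e, he⟩ := hbc
    have two : ∀ p q r s : ZMod 2, p + q + r + (r + s) = p + q + s := by decide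
    have two_comm : ∀ p q r s : ZMod 2, p + q + r + s + r = p + q + s := by decide
    have hupd : ∀ c', G.Inc e c' → IsOrientation G (Function.update hd e c') := by
      intro c' hc' f hf
      by_cases hfe : f = e
      · subst hfe; rwa [Function.update_self]
      · rw [Function.update_of_ne hfe]; exact hor f hf
    -- Whichever end `e` enters now, reversing it toggles both `b` and `c`, which passes the change
    -- of parity from `b` on to `c`.
    rcases (hor e he.edge_mem).eq_or_eq_of_isLink he with hb | hc
    · refine ⟨_, hupd c he.inc_right, fun z => ?_⟩
      rw [hflip hd e b c he.edge_mem hb, hpar, add_assoc, two]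
    · refine ⟨_, hupd b he.inc_left, fun z => ?_⟩
      rw [hflip hd e c b he.edge_mem hc, hpar, two_comm]

/-- A multigraph all of whose components are even has an even orientation. -/
lemma exists_isEvenOrientation [Finite β] [Nonempty α] {G : Graph α β}
    (hG : ∀ C, IsComponent C G → IsEvenMultigraph C) : ∃ head, IsEvenOrientation G head := by
  classical
  have := Fintype.ofFinite β
  let odd (head : β → α) : Set α := {x | ((incoming G head x).ncard : ZMod 2) ≠ 0}
  have hfin : ∀ head, (odd head).Finite := by
    intro head
    refine (Set.finite_range head).subset fun x hx => ?_
    by_contra hne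
    refine hx ?_
    have : incoming G head x = ∅ := by
      ext e
      simp only [incoming, Set.mem_ofPred_eq, Set.mem_empty_iff_false, iff_false, not_and]
      exact fun _ h => hne ⟨e, h⟩
    simp [this]
  have hex : ∃ n head, IsOrientation G head ∧ (odd head).ncard = n := by
    have : ∀ e, ∃ x, e ∈ G.edgeSet → G.Inc e x := by
      intro e
      by_cases he : e ∈ G.edgeSet
      · obtain ⟨x, y, h⟩ := Graph.exists_isLink_of_mem_edgeSet he
        exact ⟨x, fun _ => h.inc_left⟩
      · exact ⟨Classical.arbitrary α, fun h => (he h).elim⟩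
    choose head hhead using this
    exact ⟨_, head, hhead, rfl⟩
  -- An orientation with the fewest vertices of odd indegree.
  obtain ⟨head, hor, hn⟩ := Nat.find_spec hex
  refine ⟨head, hor, fun x hx => ?_⟩
  rw [← ZMod.natCast_eq_zero_iff_even]
  by_contra hxodd
  -- The indegrees in the component of `x` sum to its even number of edges, so `x` cannot be its
  -- only odd vertex.
  obtain ⟨y, hxy, hreach, hyodd⟩ : ∃ y, y ≠ x ∧ Relation.ReflTransGen G.Adj x y ∧
      ((incoming G head y).ncard : ZMod 2) ≠ 0 := by
    by_contra! hno
    have hcomp := hG _ (isComponent_componentOf hx)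
    have hmem : ∀ e, e ∈ (componentOf G x).edgeSet ↔
        e ∈ G.edgeSet ∧ Relation.ReflTransGen G.Adj x (head e) := by
      intro e
      constructor
      · rintro ⟨a, b, hab, ha⟩
        refine ⟨hab.edge_mem, ?_⟩
        rcases (hor e hab.edge_mem).eq_or_eq_of_isLink hab with h | h
        · rwa [h]
        · rw [h]; exact ha.tail ⟨e, hab⟩
      · rintro ⟨he, h⟩
        obtain ⟨b, hb⟩ := hor e he
        exact ⟨_, b, hb, h⟩
    let s : Finset β := Finset.univ.filter (· ∈ (componentOf G x).edgeSet)
    have hs : (s.card : ZMod 2) = 0 := by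
      rw [ZMod.natCast_eq_zero_iff_even]
      have : (componentOf G x).edgeSet = (s : Set β) := by ext; simp [s]
      rwa [IsEvenMultigraph, this, Set.ncard_coe_finset] at hcomp
    have hfib : ∀ z, Relation.ReflTransGen G.Adj x z →
        (s.filter (head · = z)).card = (incoming G head z).ncard := by
      intro z hz
      rw [← Set.ncard_coe_finset]
      congr 1
      ext e
      simp only [s, Finset.coe_filter, Finset.mem_filter, Finset.mem_univ, true_and, hmem,
        incoming, Set.mem_ofPred_eq]
      constructor
      · exact fun h => ⟨h.1.1, h.2⟩
      · exact fun h => ⟨⟨h.1, h.2 ▸ hz⟩, h.2⟩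
    rw [Finset.card_eq_sum_card_image head s, Nat.cast_sum] at hs
    have hz : ∀ z ∈ s.image head, Relation.ReflTransGen G.Adj x z := by
      intro z hz
      obtain ⟨e, he, rfl⟩ := Finset.mem_image.1 hz
      exact ((hmem e).1 (Finset.mem_filter.1 he).2).2
    rw [Finset.sum_congr rfl (fun z h => by rw [hfib z (hz z h)])] at hs
    have hxs : x ∈ s.image head := by
      have : (incoming G head x).Nonempty := by
        rw [Set.nonempty_iff_ne_empty]
        intro h
        simp [h] at hxodd
      obtain ⟨e, he, hex⟩ := this
      refine Finset.mem_image.2 ⟨e, Finset.mem_filter.2 ⟨Finset.mem_univ _, ?_⟩, hex⟩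
      exact (hmem e).2 ⟨he, hex ▸ .refl⟩
    rw [Finset.sum_eq_single_of_mem x hxs (fun z h hne => hno z hne (hz z h))] at hs
    exact hxodd hs
  obtain ⟨head', hor', hpar⟩ := hor.exists_flip_walk hreach
  refine Nat.find_min hex (m := (odd head').ncard) ?_ ⟨head', hor', rfl⟩
  rw [← hn]
  have two : ∀ p : ZMod 2, p ≠ 0 → p + 1 = 0 := by decide
  refine Set.ncard_lt_ncard ⟨fun z hz => ?_, fun h => ?_⟩ (hfin _)
  · simp only [odd, Set.mem_ofPred_eq, hpar] at hz ⊢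
    by_cases h₁ : z = x
    · subst h₁; exact hxodd
    · by_cases h₂ : z = y
      · subst h₂; exact hyodd
      · simpa [h₁, h₂] using hz
  · have := h (show x ∈ odd head from hxodd)
    simp only [odd, Set.mem_ofPred_eq, hpar, if_neg hxy.symm, if_true, add_zero] at this
    exact this (two _ hxodd)

/-- Even orientations of the two parts of an edge-partition form an even orientation. -/
lemma IsEdgePartition.exists_head [Finite β] {G G₁ G₂ : Graph α β} (h : IsEdgePartition G G₁ G₂)
    {h₁ h₂ : β → α} (e₁ : IsEvenOrientation G₁ h₁) (e₂ : IsEvenOrientation G₂ h₂) :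
    ∃ head, IsEvenOrientation G head ∧
      ∀ x, (incoming G head x).ncard = 2 → ∀ v ∈ incoming G head x, ∀ w ∈ incoming G head x,
        (v ∈ G₁.edgeSet ↔ w ∈ G₁.edgeSet) := by
  classical
  let head : β → α := fun e => if e ∈ G₁.edgeSet then h₁ e else h₂ e
  have hd₂ : ∀ e ∈ G₂.edgeSet, e ∉ G₁.edgeSet := fun e he he' =>
    Set.disjoint_left.1 h.disjoint he' he
  have hunion : ∀ x, incoming G head x = incoming G₁ h₁ x ∪ incoming G₂ h₂ x := by
    intro x
    ext e
    simp only [incoming, Set.mem_ofPred_eq, Set.mem_union, ← h.union_eq, head]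
    by_cases he : e ∈ G₁.edgeSet
    · have : e ∉ G₂.edgeSet := fun h' => hd₂ e h' he
      simp [he, this]
    · simp [he]
  have hdisj : ∀ x, Disjoint (incoming G₁ h₁ x) (incoming G₂ h₂ x) := fun x =>
    h.disjoint.mono (fun _ h => h.1) (fun _ h => h.1)
  have hcard : ∀ x, (incoming G head x).ncard =
      (incoming G₁ h₁ x).ncard + (incoming G₂ h₂ x).ncard := fun x => by
    rw [hunion, Set.ncard_union_eq (hdisj x) (Set.toFinite _) (Set.toFinite _)]
  -- Parity is needed at every `x`, also at vertices missing from the subgraph, which no edge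
  -- enters.
  have hev : ∀ {H : Graph α β} {hd : β → α}, IsEvenOrientation H hd → ∀ x,
      Even (incoming H hd x).ncard := by
    intro H hd hH x
    by_cases hx : x ∈ H.vertexSet
    · exact hH.2 x hx
    · have : incoming H hd x = ∅ := by
        ext e
        simp only [incoming, Set.mem_ofPred_eq, Set.mem_empty_iff_false, iff_false, not_and]
        rintro he rfl
        exact hx (hH.1 e he).vertex_mem
      simp [this]
  refine ⟨head, ⟨fun e he => ?_, fun x _ => hcard x ▸ (hev e₁ x).add (hev e₂ x)⟩, ?_⟩
  · by_cases he₁ : e ∈ G₁.edgeSet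
    · simp only [head, he₁, if_true]
      obtain ⟨y, hy⟩ := e₁.1 e he₁
      exact ⟨y, h.left_le.isLink_mono hy⟩
    · simp only [head, he₁, if_false]
      have he₂ : e ∈ G₂.edgeSet := by
        rw [← h.union_eq] at he
        exact he.resolve_left he₁
      obtain ⟨y, hy⟩ := e₂.1 e he₂
      exact ⟨y, h.right_le.isLink_mono hy⟩
  · intro x hx v hv w hw
    obtain ⟨m, hm⟩ := hev e₁ x
    obtain ⟨n, hn⟩ := hev e₂ x
    rw [hcard] at hx
    rw [hunion] at hv hw
    -- Two even numbers with sum 2 are 0 and 2.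
    have : (incoming G₁ h₁ x).ncard = 0 ∨ (incoming G₂ h₂ x).ncard = 0 := by omega
    rcases this with h0 | h0 <;> rw [Set.ncard_eq_zero (Set.toFinite _)] at h0 <;>
      simp only [h0, Set.empty_union, Set.union_empty] at hv hw
    · simp [hd₂ v hv.1, hd₂ w hw.1]
    · simp [hv.1, hw.1]

end EvenOrientations

/-! ### From two trees to two subgraphs to even orientations -/

section Implications

variable {S : Finset Plane} {M : SimpleGraph S}

/-- If each segment has exactly one of its endpoints in `E`, then `E` has as many elements as there
are segments. -/
lemma ncard_eq_ncard_edgeSet (hM : ∀ v, ∃! w, M.Adj v w) {E : Set S}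
    (hE : ∀ v w, M.Adj v w → (v ∈ E ↔ w ∉ E)) : E.ncard = M.edgeSet.ncard := by
  choose p hp hu using hM
  refine Set.ncard_congr (fun v _ => s(v, p v)) (fun v _ => hp v) ?_ ?_
  · intro v w hv hw h
    rw [Sym2.eq_iff] at h
    rcases h with h | h
    · exact h.1
    · exact ((hE _ _ (hp w)).1 hw (h.1 ▸ hv)).elim
  · intro e
    induction e with
    | _ a b =>
    intro hab
    have hab : M.Adj a b := hab
    by_cases ha : a ∈ E
    · exact ⟨a, ha, by rw [hu a b hab]⟩
    · refine ⟨b, not_not.1 fun hb => ha ((hE a b hab).2 hb), ?_⟩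
      rw [← hu b a hab.symm, Sym2.eq_swap]

theorem HasTwoTreesExtension.hasTwoSubgraphsExtension (hM : IsPerfectMatching M)
    (heven : IsEvenMatching M) (h : HasTwoTreesExtension M) : HasTwoSubgraphsExtension M := by
  obtain ⟨L, hL, T₁, T₂, hp, ht₁, ht₂, hs⟩ := h
  have hdis := Set.disjoint_left.1 hp.disjoint
  refine ⟨L, hL, T₁, T₂, hp, fun C hC => ?_, fun C hC => ?_, hs⟩
  · rw [IsEvenMultigraph, hC.edgeSet_eq_of_isConnected ht₁.1,
      ncard_eq_ncard_edgeSet hM.2 fun v w hvw => ?_]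
    · exact heven
    · have := hs v w hvw
      have := @hdis v
      have := @hdis w
      tauto
  · rw [IsEvenMultigraph, hC.edgeSet_eq_of_isConnected ht₂.1,
      ncard_eq_ncard_edgeSet hM.2 fun v w hvw => ?_]
    · exact heven
    · have := hs v w hvw
      have := @hdis v
      have := @hdis w
      tauto

theorem HasTwoSubgraphsExtension.hasEvenlyOrientedExtension (h : HasTwoSubgraphsExtension M) :
    HasEvenlyOrientedExtension M := by
  obtain ⟨L, hL, G₁, G₂, hp, hc₁, hc₂, hs⟩ := h
  obtain ⟨h₁, e₁⟩ := exists_isEvenOrientation hc₁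
  obtain ⟨h₂, e₂⟩ := exists_isEvenOrientation hc₂
  obtain ⟨head, hev, htwo⟩ := hp.exists_head e₁ e₂
  refine ⟨L, hL, head, hev, fun C _ hC v hv w hw hvw => ?_⟩
  have hdis := Set.disjoint_left.1 hp.disjoint
  have := htwo C hC v hv w hw
  have := @hdis v
  have := @hdis w
  have := hs v w hvw
  tauto

end Implications

/-! ### Plane geometry and convexity of the complementary components -/

section Geometry

/-- The determinant of two vectors of the plane. -/
def cross (u w : Plane) : ℝ := u 0 * w 1 - u 1 * w 0

lemma cross_add_smul (x y u : Plane) (t : ℝ) : cross (x + t • y) u = cross x u + t * cross y u := by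
  simp only [cross, PiLp.add_apply, PiLp.smul_apply, smul_eq_mul]
  ring

lemma cross_smul_self (u : Plane) (t : ℝ) : cross (t • u) u = 0 := by
  simp only [cross, PiLp.smul_apply, smul_eq_mul]
  ring

lemma exists_cross_pos {u : Plane} (hu : u ≠ 0) : ∃ n : Plane, 0 < cross n u := by
  -- `u` turned by a right angle.
  refine ⟨!₂[u 1, -u 0], ?_⟩
  have : u 0 ≠ 0 ∨ u 1 ≠ 0 := by
    by_contra! h
    refine hu ?_
    ext i
    fin_cases i
    · exact h.1
    · exact h.2
  have h2 : cross !₂[u 1, -u 0] u = u 1 ^ 2 + u 0 ^ 2 := by simp [cross]; ring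
  rw [h2]
  rcases this with h | h <;> positivity

/-- Cramer's rule. -/
lemma exists_eq_add_smul_of_cross_ne_zero {u w : Plane} (h : cross u w ≠ 0) (d : Plane) :
    ∃ α β : ℝ, d = α • u + β • w := by
  refine ⟨cross d w / cross u w, cross u d / cross u w, ?_⟩
  refine PiLp.ext (Fin.forall_fin_two.2 ⟨?_, ?_⟩) <;>
    rw [PiLp.add_apply, PiLp.smul_apply, PiLp.smul_apply, smul_eq_mul, smul_eq_mul,
      div_mul_eq_mul_div, div_mul_eq_mul_div, ← add_div, eq_div_iff h] <;>
    simp only [cross] <;> ring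

lemma exists_eq_smul_of_cross_eq_zero {u w : Plane} (hw : w ≠ 0) (h : cross u w = 0) :
    ∃ r : ℝ, u = r • w := by
  obtain ⟨n, hn⟩ := exists_cross_pos hw
  obtain ⟨α, β, rfl⟩ := exists_eq_add_smul_of_cross_ne_zero hn.ne' u
  have : α * cross n w = 0 := by
    rw [← h]
    simp only [cross, PiLp.add_apply, PiLp.smul_apply, smul_eq_mul]
    ring
  rcases mul_eq_zero.1 this with h | h
  · exact ⟨β, by simp [h]⟩
  · exact absurd h hn.ne'

lemma exists_eq_add_smul_of_mem_segment {a b p : Plane} (h : p ∈ segment ℝ a b) :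
    ∃ t : ℝ, 0 ≤ t ∧ t ≤ 1 ∧ p = a + t • (b - a) := by
  rw [segment_eq_image'] at h
  obtain ⟨t, ⟨h0, h1⟩, rfl⟩ := h
  exact ⟨t, h0, h1, rfl⟩

lemma add_smul_mem_segment {a b : Plane} {t : ℝ} (h0 : 0 ≤ t) (h1 : t ≤ 1) :
    a + t • (b - a) ∈ segment ℝ a b := by
  rw [segment_eq_image']
  exact ⟨t, ⟨h0, h1⟩, rfl⟩

lemma cross_eq_zero_of_mem_segment {a b p : Plane} (h : p ∈ segment ℝ a b) :
    cross (p - a) (b - a) = 0 := by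
  obtain ⟨t, -, -, rfl⟩ := exists_eq_add_smul_of_mem_segment h
  rw [add_sub_cancel_left, cross_smul_self]

lemma cross_eq_zero_of_mem_blockedRay {D : Set Plane} {a b p : Plane} (h : p ∈ blockedRay D a b) :
    cross (p - a) (b - a) = 0 := by
  obtain ⟨t, -, -, rfl⟩ := h
  rw [add_sub_cancel_left, ← neg_sub b a, smul_neg, ← neg_smul, cross_smul_self]

lemma tendsto_add_smul (v n : Plane) : Tendsto (fun t : ℝ => v + t • n) (𝓝 0) (𝓝 v) := by
  have : Continuous fun t : ℝ => v + t • n := by fun_prop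
  simpa using this.tendsto 0

/-- `z` is the midpoint of a nondegenerate segment contained in `L`. -/
def HasSegmentThrough (L : Set Plane) (z : Plane) : Prop :=
  ∃ d : Plane, d ≠ 0 ∧ ∀ τ : ℝ, |τ| ≤ 1 → z + τ • d ∈ L

lemma HasSegmentThrough.mono {L L' : Set Plane} {z : Plane} (h : HasSegmentThrough L z)
    (hL : L ⊆ L') : HasSegmentThrough L' z :=
  let ⟨d, hd, h⟩ := h
  ⟨d, hd, fun τ hτ => hL (h τ hτ)⟩

lemma hasSegmentThrough_of_Icc {L : Set Plane} {x n : Plane} (hn : n ≠ 0) {r s t : ℝ} (hrs : r < s)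
    (hst : s < t) (h : ∀ u, r ≤ u → u ≤ t → x + u • n ∈ L) :
    HasSegmentThrough L (x + s • n) := by
  obtain ⟨ε, hε, h₁, h₂⟩ : ∃ ε > 0, ε ≤ s - r ∧ ε ≤ t - s :=
    ⟨min (s - r) (t - s), lt_min (by linarith) (by linarith), min_le_left _ _, min_le_right _ _⟩
  refine ⟨ε • n, smul_ne_zero hε.ne' hn, fun τ hτ => ?_⟩
  rw [smul_smul, add_assoc, ← add_smul]
  obtain ⟨h₃, h₄⟩ := abs_le.1 hτ
  exact h _ (by nlinarith) (by nlinarith)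

/-- In the complement of a closed set which is locally a union of segments without endpoints, two
sides of a triangle determine the third. -/
lemma segment_subset_compl_trans {L : Set Plane} (hL : IsClosed L)
    (hP : ∀ z ∈ L, HasSegmentThrough L z) {a b c : Plane} (hab : segment ℝ a b ⊆ Lᶜ)
    (hbc : segment ℝ b c ⊆ Lᶜ) : segment ℝ a c ⊆ Lᶜ := by
  by_cases hdeg : cross (c - b) (b - a) = 0
  · rcases eq_or_ne a b with rfl | hne
    · exact hbc
    obtain ⟨r, hr⟩ := exists_eq_smul_of_cross_eq_zero (sub_ne_zero.2 hne.symm) hdeg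
    intro p hp
    obtain ⟨t, h0, h1, rfl⟩ := exists_eq_add_smul_of_mem_segment hp
    -- With `b - a` as unit, the collinear points `a`, `b`, `c` have coordinates 0, 1 and `1 + r`.
    have hca : c - a = (1 + r) • (b - a) := by
      rw [add_smul, one_smul, ← hr]; abel
    rw [hca, smul_smul]
    have hbc' : ∀ k : ℝ, r ≠ 0 → 0 ≤ (k - 1) / r → (k - 1) / r ≤ 1 → a + k • (b - a) ∈ Lᶜ := by
      intro k hr0 hk0 hk1
      have := hbc (add_smul_mem_segment hk0 hk1)
      rw [hr, smul_smul, div_mul_cancel₀ _ hr0, sub_smul, one_smul] at this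
      convert this using 1
      abel
    rcases lt_or_ge (t * (1 + r)) 0 with hk | hk
    · have hr1 : 1 + r < 0 := by nlinarith
      have hr0 : r < 0 := by linarith
      refine hbc' _ hr0.ne (div_nonneg_of_nonpos (by linarith) hr0.le) ?_
      rw [div_le_one_of_neg hr0]
      nlinarith
    rcases le_or_gt (t * (1 + r)) 1 with hk1 | hk1
    · exact hab (add_smul_mem_segment hk hk1)
    · have hr0 : 0 < r := by nlinarith
      refine hbc' _ hr0.ne' (div_nonneg (by linarith) hr0.le) ?_
      rw [div_le_one hr0]
      nlinarith
  intro p hp hpL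
  have hdeg' : cross (b - a) (c - b) ≠ 0 := fun h => hdeg (by rw [cross] at *; linarith)
  -- The triangle is swept by segments from `a`: `t` fixes the point of `bc` aimed at, `s` the
  -- fraction of the way. Among the points of `L` in the triangle, one with least `t`, and then
  -- least `s`, is extremal.
  have hcont : Continuous fun x : ℝ × ℝ => a + x.1 • (b - a) + (x.1 * x.2) • (c - b) := by fun_prop
  let K : Set (ℝ × ℝ) := (Set.Icc 0 1 ×ˢ Set.Icc 0 1) ∩
    {x | a + x.1 • (b - a) + (x.1 * x.2) • (c - b) ∈ L}
  have hK : IsCompact K := (isCompact_Icc.prod isCompact_Icc).inter_right (hL.preimage hcont)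
  have hKne : K.Nonempty := by
    obtain ⟨s, h0, h1, rfl⟩ := exists_eq_add_smul_of_mem_segment hp
    refine ⟨(s, 1), ⟨⟨h0, h1⟩, by norm_num⟩, ?_⟩
    simp only [Set.mem_ofPred_eq]
    convert hpL using 1
    module
  obtain ⟨t, ⟨x, hx, hxt⟩, htmin⟩ := (hK.image continuous_snd).exists_isLeast (hKne.image _)
  have hK' : IsCompact (K ∩ {y | y.2 = t}) := hK.inter_right (isClosed_eq continuous_snd
    continuous_const)
  obtain ⟨s, ⟨y, ⟨hy, hyt⟩, rfl⟩, hsmin⟩ :=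
    (hK'.image continuous_fst).exists_isLeast (Set.Nonempty.image _ ⟨x, hx, hxt⟩)
  obtain ⟨s, t'⟩ := y
  obtain rfl : t' = t := hyt
  clear hx hxt
  simp only at htmin hsmin
  obtain ⟨⟨⟨hs0, hs1⟩, ht0, ht1⟩, hz⟩ := hy
  simp only [Set.mem_ofPred_eq] at hs0 hs1 ht0 ht1 hz
  have ht0' : 0 < t' := by
    refine lt_of_le_of_ne ht0 ?_
    rintro rfl
    refine hab (add_smul_mem_segment hs0 hs1) ?_
    simpa using hz
  have hs0' : 0 < s := by
    refine lt_of_le_of_ne hs0 ?_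
    rintro rfl
    refine hab (left_mem_segment ℝ a b) ?_
    simpa using hz
  have hs1' : s < 1 := by
    refine lt_of_le_of_ne hs1 ?_
    rintro rfl
    refine hbc (add_smul_mem_segment ht0 ht1) ?_
    simpa using hz
  obtain ⟨d, hd, hdL⟩ := hP _ hz
  obtain ⟨α, β, rfl⟩ := exists_eq_add_smul_of_cross_ne_zero hdeg' d
  have hlim : ∀ p q : ℝ, Tendsto (fun τ : ℝ => p + τ * q) (𝓝 0) (𝓝 p) := fun p q => by
    have : Continuous fun τ : ℝ => p + τ * q := by fun_prop
    simpa using this.tendsto 0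
  have hev : ∀ᶠ τ : ℝ in 𝓝 0, (0 < s + τ * α ∧ s + τ * α < 1 ∧ 0 < s * t' + τ * β) ∧ |τ| ≤ 1 :=
    (((hlim s α).eventually (lt_mem_nhds hs0')).and (((hlim s α).eventually (gt_mem_nhds hs1')).and
      ((hlim (s * t') β).eventually (lt_mem_nhds (by positivity))))).and
      ((continuous_abs.tendsto' 0 0 abs_zero).eventually (ge_mem_nhds one_pos))
  obtain ⟨δ, hδ, hball⟩ := Metric.eventually_nhds_iff.1 hev
  -- Moving by `τ` along `d` changes `t'` to `(s * t' + τ * β) / (s + τ * α)`. Minimality of `t'`,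
  -- for both signs of `τ`, forces `β = t' * α`; minimality of `s` then forces `α = 0`, so `d = 0`.
  have key : ∀ τ : ℝ, |τ| < δ → 0 ≤ τ * (β - t' * α) ∧ (β = t' * α → 0 ≤ τ * α) := by
    intro τ hτ
    obtain ⟨⟨h₁, h₂, h₃⟩, h₄⟩ := hball (y := τ) (by simpa using hτ)
    have hmem := hdL τ h₄
    have heq : a + s • (b - a) + (s * t') • (c - b) + τ • (α • (b - a) + β • (c - b)) =
        a + (s + τ * α) • (b - a) + (s * t' + τ * β) • (c - b) := by module
    rw [heq] at hmem
    constructor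
    · by_contra! hneg
      have hlt : (s * t' + τ * β) / (s + τ * α) < t' := by
        rw [div_lt_iff₀ h₁]; nlinarith
      refine absurd (htmin ⟨(s + τ * α, (s * t' + τ * β) / (s + τ * α)),
        ⟨⟨⟨h₁.le, h₂.le⟩, (div_pos h₃ h₁).le, hlt.le.trans ht1⟩, ?_⟩, rfl⟩) (not_le.2 hlt)
      simp only [Set.mem_ofPred_eq]
      rwa [mul_div_cancel₀ _ h₁.ne']
    · rintro rfl
      have := hsmin ⟨(s + τ * α, t'), ⟨⟨⟨⟨h₁.le, h₂.le⟩, ht0, ht1⟩, ?_⟩, rfl⟩, rfl⟩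
      · simp only at this; linarith
      · simp only [Set.mem_ofPred_eq]
        convert hmem using 3
        ring
  have hpos := key (δ / 2) (by rw [abs_of_pos] <;> linarith)
  have hneg := key (-(δ / 2)) (by rw [abs_neg, abs_of_pos] <;> linarith)
  have hβ : β = t' * α := by nlinarith [hpos.1, hneg.1]
  have hα : α = 0 := by nlinarith [hpos.2 hβ, hneg.2 hβ]
  exact hd (by simp [hβ, hα])

/-- By the triangle lemma, the points of the component visible from `x` and those not visible from
`x` both form open sets, so connectedness leaves only the visible ones. -/
lemma convex_connectedComponentIn_compl {L : Set Plane} (hL : IsClosed L)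
    (hP : ∀ z ∈ L, HasSegmentThrough L z) (x₀ : Plane) :
    Convex ℝ (connectedComponentIn Lᶜ x₀) := by
  rw [convex_iff_segment_subset]
  intro x hx y hy
  have hxL : x ∈ Lᶜ := connectedComponentIn_subset _ _ hx
  rw [connectedComponentIn_eq hx] at hy ⊢
  have hnear : ∀ {y}, y ∈ Lᶜ → ∃ ε > 0, ∀ z ∈ Metric.ball y ε, segment ℝ y z ⊆ Lᶜ := by
    intro y hy
    obtain ⟨ε, hε, h⟩ := Metric.isOpen_iff.1 hL.isOpen_compl y hy
    exact ⟨ε, hε, fun z hz =>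
      ((convex_ball y ε).segment_subset (Metric.mem_ball_self hε) hz).trans h⟩
  have hsub : segment ℝ x y ⊆ Lᶜ := by
    refine IsPreconnected.subset_left_of_subset_union (u := {y | segment ℝ x y ⊆ Lᶜ})
      (v := {y | y ∈ Lᶜ ∧ ¬ segment ℝ x y ⊆ Lᶜ}) ?_ ?_ ?_ ?_ ?_ isPreconnected_connectedComponentIn
      hy
    · rw [Metric.isOpen_iff]
      intro y hy
      obtain ⟨ε, hε, h⟩ := hnear (hy (right_mem_segment ℝ x y))
      exact ⟨ε, hε, fun z hz => segment_subset_compl_trans hL hP hy (h z hz)⟩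
    · rw [Metric.isOpen_iff]
      intro y hy
      obtain ⟨ε, hε, h⟩ := hnear hy.1
      refine ⟨ε, hε, fun z hz => ⟨h z hz (right_mem_segment ℝ y z), fun hz' => hy.2 ?_⟩⟩
      exact segment_subset_compl_trans hL hP hz' (segment_symm ℝ y z ▸ h z hz)
    · exact Set.disjoint_left.2 fun y h h' => h'.2 h
    · intro y hy
      have := connectedComponentIn_subset _ _ hy
      by_cases h : segment ℝ x y ⊆ Lᶜ
      · exact Or.inl h
      · exact Or.inr ⟨this, h⟩
    · exact ⟨x, mem_connectedComponentIn hxL, by simpa using hxL⟩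
  exact (convex_segment x y).isPreconnected.subset_connectedComponentIn
    (left_mem_segment ℝ x y) hsub

end Geometry

/-! ### Cells near a boundary point -/

section Cells

variable {L C D : Set Plane}

lemma subset_compl_of_mem_cells (hC : C ∈ cells L) : C ⊆ Lᶜ := by
  obtain ⟨x, -, rfl⟩ := hC
  exact connectedComponentIn_subset _ _

lemma eq_connectedComponentIn_of_mem_cells (hC : C ∈ cells L) {x : Plane} (hx : x ∈ C) :
    C = connectedComponentIn Lᶜ x := by
  obtain ⟨y, -, rfl⟩ := hC
  exact connectedComponentIn_eq hx

lemma eq_of_mem_cells (hC : C ∈ cells L) (hD : D ∈ cells L) {x : Plane} (hx : x ∈ C)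
    (hx' : x ∈ D) : C = D := by
  rw [eq_connectedComponentIn_of_mem_cells hC hx, ← eq_connectedComponentIn_of_mem_cells hD hx']

lemma isOpen_of_mem_cells (hL : IsClosed L) (hC : C ∈ cells L) : IsOpen C := by
  obtain ⟨x, -, rfl⟩ := hC
  exact hL.isOpen_compl.connectedComponentIn

lemma mem_of_mem_closure_of_mem_cells (hL : IsClosed L) (hC : C ∈ cells L) {x : Plane}
    (hx : x ∈ closure C) (hxL : x ∉ L) : x ∈ C := by
  have hD : connectedComponentIn Lᶜ x ∈ cells L := ⟨x, hxL, rfl⟩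
  obtain ⟨y, hyD, hyC⟩ := mem_closure_iff.1 hx _ (isOpen_of_mem_cells hL hD)
    (mem_connectedComponentIn hxL)
  rw [eq_of_mem_cells hC hD hyC hyD]
  exact mem_connectedComponentIn hxL

/-- A point near which `L` is contained in a line is on the boundary of exactly two cells. -/
lemma exists_cells_eq_pair (hL : IsClosed L) (hP : ∀ z ∈ L, HasSegmentThrough L z) {v u : Plane}
    (hu : u ≠ 0) (hv : v ∈ L) (hloc : ∀ᶠ p in 𝓝 v, p ∈ L → cross (p - v) u = 0) :
    ∃ C D, C ≠ D ∧ {X | X ∈ cells L ∧ v ∈ frontier X} = {C, D} := by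
  obtain ⟨ε, hε, hball⟩ := Metric.eventually_nhds_iff_ball.1 hloc
  obtain ⟨n, hn⟩ := exists_cross_pos hu
  -- The sign `σ` selects a side of the line; the half-disc there is convex and misses `L`, so it
  -- lies in one cell.
  have hside : ∀ σ : ℝ, σ * σ = 1 → ∃ C ∈ cells L, v ∈ frontier C ∧
      ∀ p ∈ Metric.ball v ε, 0 < σ * cross (p - v) u → p ∈ C := by
    intro σ hσ
    have hconv : Convex ℝ (Metric.ball v ε ∩ {p | 0 < σ * cross (p - v) u}) := by
      refine (convex_ball v ε).inter ?_
      intro x hx y hy a b ha hb hab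
      simp only [Set.mem_ofPred_eq] at hx hy ⊢
      have : σ * cross (a • x + b • y - v) u =
          a * (σ * cross (x - v) u) + b * (σ * cross (y - v) u) := by
        obtain rfl : b = 1 - a := by linarith
        simp only [cross, PiLp.add_apply, PiLp.sub_apply, PiLp.smul_apply, smul_eq_mul]
        ring
      rw [this]
      rcases ha.eq_or_lt with rfl | ha
      · obtain rfl : b = 1 := by linarith
        simpa using hy
      · positivity
    have hsub : Metric.ball v ε ∩ {p | 0 < σ * cross (p - v) u} ⊆ Lᶜ := by
      rintro p ⟨hp, hpos⟩ hpL
      simp [hball p hp hpL] at hpos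
    have hlim : ∀ᶠ t : ℝ in 𝓝[>] 0,
        v + t • (σ • n) ∈ Metric.ball v ε ∩ {p | 0 < σ * cross (p - v) u} := by
      have h₁ := ((tendsto_add_smul v (σ • n)).mono_left
        (nhdsWithin_le_nhds (s := Set.Ioi 0))).eventually
        (Metric.ball_mem_nhds v hε)
      filter_upwards [h₁, self_mem_nhdsWithin] with t ht htpos
      refine ⟨ht, ?_⟩
      have : σ * cross (v + t • σ • n - v) u = (σ * σ) * (t * cross n u) := by
        simp only [cross, PiLp.add_apply, PiLp.sub_apply, PiLp.smul_apply, smul_eq_mul]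
        ring
      simp only [Set.mem_ofPred_eq, this, hσ, one_mul]
      exact mul_pos htpos hn
    obtain ⟨t, ht⟩ := hlim.exists
    have hC : connectedComponentIn Lᶜ (v + t • (σ • n)) ∈ cells L := ⟨_, hsub ht, rfl⟩
    have hmem := hconv.isPreconnected.subset_connectedComponentIn ht hsub
    refine ⟨_, hC, ?_, fun p hp hpos => hmem ⟨hp, hpos⟩⟩
    rw [(isOpen_of_mem_cells hL hC).frontier_eq]
    refine ⟨closure_mono hmem (mem_closure_of_tendsto ((tendsto_add_smul v (σ • n)).mono_left
      nhdsWithin_le_nhds) hlim), fun h => subset_compl_of_mem_cells hC h hv⟩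
  obtain ⟨C, hC, hvC, hCmem⟩ := hside 1 (by norm_num)
  obtain ⟨D, hD, hvD, hDmem⟩ := hside (-1) (by norm_num)
  have hcross : ∀ t : ℝ, cross (v + t • n - v) u = t * cross n u := fun t => by
    rw [add_sub_cancel_left]
    simp only [cross, PiLp.smul_apply, smul_eq_mul]
    ring
  refine ⟨C, D, ?_, ?_⟩
  -- If both half-discs were in one cell, its convexity would put their common midpoint `v ∈ L` into
  -- it.
  · rintro rfl
    have hC' := hC
    obtain ⟨δ, hδ, hδb⟩ := Metric.eventually_nhds_iff.1
      ((tendsto_add_smul v n).eventually (Metric.ball_mem_nhds v hε))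
    have h₁ := hCmem (v + (δ / 2) • n)
      (hδb (by rw [Real.dist_eq, sub_zero, abs_of_pos] <;> linarith))
      (by rw [hcross]; positivity)
    have h₂ := hDmem (v + (-(δ / 2)) • n)
      (hδb (by rw [Real.dist_eq, sub_zero, abs_neg, abs_of_pos] <;> linarith))
      (by rw [hcross]; nlinarith)
    obtain ⟨x, -, hx⟩ := hC
    have hconv : Convex ℝ C := hx ▸ convex_connectedComponentIn_compl hL hP x
    have := hconv h₁ h₂ (by norm_num : (0 : ℝ) ≤ 1 / 2) (by norm_num : (0 : ℝ) ≤ 1 / 2)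
      (by norm_num)
    refine subset_compl_of_mem_cells hC' this ?_
    convert hv using 1
    module
  · ext X
    simp only [Set.mem_ofPred_eq, Set.mem_insert_iff, Set.mem_singleton_iff]
    constructor
    · rintro ⟨hX, hvX⟩
      have hopen := isOpen_of_mem_cells hL hX
      -- A point of `X` near `v` that happens to be on the line is pushed off it, which is possible
      -- as `X` is open.
      obtain ⟨q, hqball, hqX, hq⟩ : ∃ q ∈ Metric.ball v ε, q ∈ X ∧ cross (q - v) u ≠ 0 := by
        obtain ⟨q, hqb, hqX⟩ := mem_closure_iff.1 (frontier_subset_closure hvX) _ Metric.isOpen_ball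
          (Metric.mem_ball_self hε)
        by_cases hq : cross (q - v) u = 0
        · have := ((tendsto_add_smul q n).mono_left
            (nhdsWithin_le_nhds (s := Set.Ioi 0))).eventually
            ((Metric.isOpen_ball.inter hopen).mem_nhds ⟨hqb, hqX⟩)
          obtain ⟨t, ht, htpos⟩ := (this.and (self_mem_nhdsWithin (s := Set.Ioi (0 : ℝ)))).exists
          refine ⟨_, ht.1, ht.2, ?_⟩
          rw [add_sub_right_comm, cross_add_smul, hq, zero_add]
          exact (mul_pos htpos hn).ne'
        · exact ⟨q, hqb, hqX, hq⟩
      rcases hq.lt_or_gt with hq | hq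
      · exact Or.inr (eq_of_mem_cells hX hD hqX (hDmem q hqball (by linarith)))
      · exact Or.inl (eq_of_mem_cells hX hC hqX (hCmem q hqball (by linarith)))
    · rintro (rfl | rfl)
      · exact ⟨hC, hvC⟩
      · exact ⟨hD, hvD⟩

/-- Two boundary points of a cell span a segment through the cell, unless the second one is on the
line that carries `L` near the first one. -/
lemma openSegment_subset_of_mem_cells (hL : IsClosed L) (hP : ∀ z ∈ L, HasSegmentThrough L z)
    (hC : C ∈ cells L) {v w u : Plane} (hv : v ∈ closure C) (hw : w ∈ closure C)
    (hloc : ∀ᶠ p in 𝓝 v, p ∈ L → cross (p - v) u = 0) (hwu : cross (w - v) u ≠ 0) :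
    openSegment ℝ v w ⊆ C := by
  have hconv : Convex ℝ C := by
    obtain ⟨x, -, rfl⟩ := hC
    exact convex_connectedComponentIn_compl hL hP x
  have hint := (isOpen_of_mem_cells hL hC).interior_eq
  -- Just after `v` the segment is off the line, hence off `L`, while staying in the convex closure
  -- of `C`.
  have hev : ∀ᶠ t : ℝ in 𝓝[>] 0, v + t • (w - v) ∈ C := by
    filter_upwards [((tendsto_add_smul v (w - v)).mono_left nhdsWithin_le_nhds).eventually hloc,
      self_mem_nhdsWithin, nhdsWithin_le_nhds (gt_mem_nhds one_pos)] with t ht htpos ht1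
    refine mem_of_mem_closure_of_mem_cells hL hC
      (hconv.closure.segment_subset hv hw (add_smul_mem_segment (le_of_lt htpos) ht1.le))
      fun hmem => ?_
    have := ht hmem
    rw [show v + t • (w - v) - v = (0 : Plane) + t • (w - v) by rw [zero_add, add_sub_cancel_left],
      cross_add_smul] at this
    simp [cross] at this
    rcases this with h | h
    · exact (ne_of_gt htpos) h
    · exact hwu (by simpa [cross] using h)
  intro z hz
  rw [openSegment_eq_image'] at hz
  obtain ⟨s, ⟨hs0, hs1⟩, rfl⟩ := hz
  obtain ⟨t, htC, hts, ht0⟩ := (hev.and (((gt_mem_nhds hs0).filter_mono nhdsWithin_le_nhds).and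
    (self_mem_nhdsWithin (s := Set.Ioi (0 : ℝ))))).exists
  rw [← hint] at htC
  have ht0 : 0 < t := ht0
  have h := hconv.openSegment_interior_closure_subset_interior htC hw
  rw [hint] at h
  refine h ⟨(1 - s) / (1 - t), (s - t) / (1 - t), ?_, ?_, ?_, ?_⟩
  · exact div_pos (by linarith) (by linarith)
  · exact div_pos (by linarith) (by linarith)
  · field_simp [(by linarith : 1 - t ≠ 0)]; ring
  · have h1t : 1 - t ≠ 0 := by linarith
    ext i
    simp only [PiLp.add_apply, PiLp.smul_apply, PiLp.sub_apply, smul_eq_mul]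
    field_simp
    ring

end Cells

/-! ### The local shape of an extension -/

section Extensions

variable {S : Finset Plane} {M : SimpleGraph S}

lemma GeneralPosition.eq_or_eq (hS : GeneralPosition S) {a c d : S} (hcd : c ≠ d)
    (h : cross ((a : Plane) - c) ((d : Plane) - c) = 0) : a = c ∨ a = d := by
  by_contra! hne
  have hcd' : (d : Plane) - c ≠ 0 := sub_ne_zero.2 fun h => hcd (Subtype.ext h.symm)
  obtain ⟨r, hr⟩ := exists_eq_smul_of_cross_eq_zero hcd' h
  refine hS a a.2 c c.2 d d.2 (fun h => hne.1 (Subtype.ext h)) (fun h => hne.2 (Subtype.ext h))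
    (fun h => hcd (Subtype.ext h)) ?_
  rw [collinear_iff_of_mem (p₀ := (c : Plane)) (by simp)]
  refine ⟨(d : Plane) - c, ?_⟩
  simp only [Set.mem_insert_iff, Set.mem_singleton_iff, forall_eq_or_imp, forall_eq]
  exact ⟨⟨r, by rw [← hr]; simp⟩, ⟨0, by simp⟩, ⟨1, by simp⟩⟩

/-- Keeps each endpoint off the line of every other segment, so that neither that segment nor its
extension comes near it. -/
lemma cross_ne_zero_of_adj (hS : GeneralPosition S) (hM : ∀ v, ∃! w, M.Adj v w) {v w a b : S}
    (hvw : M.Adj v w) (hab : M.Adj a b) (hne : s(a, b) ≠ s(v, w)) :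
    cross ((v : Plane) - a) ((b : Plane) - a) ≠ 0 := by
  intro h
  rcases hS.eq_or_eq hab.ne h with rfl | rfl
  · exact hne (by rw [(hM v).unique hab hvw])
  · exact hne (by rw [(hM v).unique hab.symm hvw, Sym2.eq_swap])

lemma isClosed_segment (a b : Plane) : IsClosed (segment ℝ a b) := by
  rw [segment_eq_image_lineMap]
  exact (isCompact_Icc.image (by fun_prop)).isClosed

lemma isClosed_segmentUnion : IsClosed (segmentUnion M) := by
  have : segmentUnion M = ⋃ v : S, ⋃ w : S, {p | M.Adj v w ∧ p ∈ segment ℝ (v : Plane) w} := by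
    ext p; simp [segmentUnion]
  rw [this]
  refine isClosed_iUnion_of_finite fun v => isClosed_iUnion_of_finite fun w => ?_
  exact isClosed_const.inter (isClosed_segment _ _)

lemma isClosed_blockedRay (D : Set Plane) {v w : Plane} (hvw : v ≠ w) :
    IsClosed (blockedRay D v w) := by
  have h' : IsClosed {t : ℝ | ∀ u, 0 < u → u < t → v + u • (v - w) ∉ D} := by
    refine IsSeqClosed.isClosed ?_
    intro s t hs hlim u hu hut
    obtain ⟨n, hn⟩ := (hlim.eventually (lt_mem_nhds hut)).exists
    exact hs n u hu hn
  have h : IsClosed {t : ℝ | 0 ≤ t ∧ ∀ u, 0 < u → u < t → v + u • (v - w) ∉ D} :=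
    isClosed_Ici.inter h'
  have hemb : Topology.IsClosedEmbedding fun t : ℝ => v + t • (v - w) :=
    (Homeomorph.addLeft v).isClosedEmbedding.comp
      (isClosedEmbedding_smul_left (sub_ne_zero.2 hvw))
  convert hemb.isClosedMap _ h using 1
  ext p
  simp only [blockedRay, Set.mem_ofPred_eq, Set.mem_image, and_assoc]
  exact exists_congr fun t => and_congr_right fun _ => and_congr_right fun _ => eq_comm

/-- The properties of the union `D` of the segments of `M` and the extensions of the segments in
`l`, from which the shape of the cells of a complete extension follows. -/
structure IsPartialExtension (M : SimpleGraph S) (l : List (Sym2 S)) (D : Set Plane) : Prop where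
  isClosed : IsClosed D
  segmentUnion_subset : segmentUnion M ⊆ D
  near_line : ∀ v w : S, M.Adj v w →
    ∀ᶠ p in 𝓝 (v : Plane), p ∈ D → cross (p - v) ((w : Plane) - v) = 0
  near_segment : ∀ v w : S, M.Adj v w → s(v, w) ∉ l →
    ∀ᶠ p in 𝓝 (v : Plane), p ∈ D → p ∈ segment ℝ (v : Plane) w
  through : ∀ z ∈ D, HasSegmentThrough D z ∨ ∃ v w : S, M.Adj v w ∧ s(v, w) ∉ l ∧ z = v

lemma isPartialExtension_segmentUnion (hS : GeneralPosition S) (hM : ∀ v, ∃! w, M.Adj v w) :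
    IsPartialExtension M [] (segmentUnion M) := by
  have hnear : ∀ v w : S, M.Adj v w →
      ∀ᶠ p in 𝓝 (v : Plane), p ∈ segmentUnion M → p ∈ segment ℝ (v : Plane) w := by
    intro v w hvw
    have : ∀ a b : S, ∀ᶠ p in 𝓝 (v : Plane), M.Adj a b → s(a, b) ≠ s(v, w) →
        p ∉ segment ℝ (a : Plane) b := by
      intro a b
      by_cases h : M.Adj a b ∧ s(a, b) ≠ s(v, w)
      · have hv : (v : Plane) ∈ (segment ℝ (a : Plane) b)ᶜ := fun hv =>
          cross_ne_zero_of_adj hS hM hvw h.1 h.2 (cross_eq_zero_of_mem_segment hv)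
        filter_upwards [(isClosed_segment _ _).isOpen_compl.mem_nhds hv] with p hp _ _ using hp
      · exact Eventually.of_forall fun p h₁ h₂ => (h ⟨h₁, h₂⟩).elim
    filter_upwards [eventually_all.2 fun a => eventually_all.2 (this a)] with p hp
    rintro ⟨a, b, hab, hpab⟩
    by_contra hpv
    refine hp a b hab (fun h => hpv ?_) hpab
    rcases Sym2.eq_iff.1 h with ⟨rfl, rfl⟩ | ⟨rfl, rfl⟩
    · exact hpab
    · rwa [segment_symm]
  refine ⟨isClosed_segmentUnion, subset_rfl, fun v w hvw => ?_, fun v w hvw _ => hnear v w hvw,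
    ?_⟩
  · filter_upwards [hnear v w hvw] with p hp hpD using cross_eq_zero_of_mem_segment (hp hpD)
  · rintro z ⟨v, w, hvw, hz⟩
    obtain ⟨t, h0, h1, rfl⟩ := exists_eq_add_smul_of_mem_segment hz
    rcases h0.eq_or_lt with rfl | h0
    · exact Or.inr ⟨v, w, hvw, by simp, by simp⟩
    rcases h1.eq_or_lt with rfl | h1
    · exact Or.inr ⟨w, v, hvw.symm, by simp, by simp⟩
    · have hne : (w : Plane) - v ≠ 0 := sub_ne_zero.2 fun h => hvw.ne (Subtype.ext h.symm)
      exact Or.inl (hasSegmentThrough_of_Icc hne h0 h1 fun u hu0 hu1 =>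
        ⟨v, w, hvw, add_smul_mem_segment hu0 hu1⟩)

/-- Since `D` is only the segment itself near an endpoint not yet extended, the new ray has positive
length and turns that endpoint into an inner point. The ray stops only at points of `D`, so it
creates no new loose end. -/
lemma IsPartialExtension.extendSegment (hS : GeneralPosition S) (hM : ∀ v, ∃! w, M.Adj v w)
    {l : List (Sym2 S)} {D : Set Plane} (hD : IsPartialExtension M l D) {e : Sym2 S}
    (he : e ∈ M.edgeSet) (hel : e ∉ l) :
    IsPartialExtension M (l ++ [e]) (extendSegment D e) := by
  have hsub : D ⊆ CompatibleMatchings.extendSegment D e := Set.subset_union_left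
  have hmem : ∀ {v w : S}, e = s(v, w) → blockedRay D v w ⊆
      CompatibleMatchings.extendSegment D e := fun h p hp => Or.inr ⟨_, _, h, hp⟩
  have hadj : ∀ {v w : S}, e = s(v, w) → M.Adj v w := fun h => by rwa [h] at he
  have hoff : ∀ v w : S, M.Adj v w → e ≠ s(v, w) →
      ∀ᶠ p in 𝓝 (v : Plane), p ∈ CompatibleMatchings.extendSegment D e → p ∈ D := by
    intro v w hvw hne
    have : ∀ a b : S, ∀ᶠ p in 𝓝 (v : Plane), e = s(a, b) → p ∉ blockedRay D a b := by
      intro a b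
      by_cases h : e = s(a, b)
      · have hab := hadj h
        have hv : (v : Plane) ∈ (blockedRay D a b)ᶜ := fun hv =>
          cross_ne_zero_of_adj hS hM hvw hab (h ▸ hne) (cross_eq_zero_of_mem_blockedRay hv)
        filter_upwards [(isClosed_blockedRay D
          fun h => hab.ne (Subtype.ext h)).isOpen_compl.mem_nhds hv] with p hp _ using hp
      · exact Eventually.of_forall fun p h' => (h h').elim
    filter_upwards [eventually_all.2 fun a => eventually_all.2 (this a)] with p hp hpe
    rcases hpe with h | ⟨a, b, hab, hpab⟩
    · exact h
    · exact (hp a b hab hpab).elim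
  have hend : ∀ v w : S, e = s(v, w) →
      HasSegmentThrough (CompatibleMatchings.extendSegment D e) (v : Plane) := by
    intro v w h
    have hvw := hadj h
    have hne : (v : Plane) - w ≠ 0 := sub_ne_zero.2 fun h => hvw.ne (Subtype.ext h)
    obtain ⟨δ, hδ, hδb⟩ := Metric.eventually_nhds_iff.1
      ((tendsto_add_smul (v : Plane) (v - w)).eventually (hD.near_segment v w hvw (h ▸ hel)))
    have hray : ∀ u : ℝ, 0 ≤ u → u ≤ δ / 2 → (v : Plane) + u • ((v : Plane) - w) ∈
        blockedRay D v w := by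
      refine fun u hu0 hu1 => ⟨u, hu0, fun r hr0 hru hrD => ?_, rfl⟩
      -- An obstacle this close to `v` would lie on the segment `vw`, on the other side of `v`.
      obtain ⟨t, ht0, -, ht⟩ := exists_eq_add_smul_of_mem_segment
        (hδb (y := r) (by rw [Real.dist_eq, sub_zero, abs_of_pos hr0]; linarith) hrD)
      rw [add_right_inj, ← neg_sub (v : Plane) w, smul_neg, ← neg_smul] at ht
      have := smul_left_injective ℝ hne ht
      linarith
    -- Parameter -1 is the endpoint `w`; positive parameters are on the new ray.
    have := hasSegmentThrough_of_Icc (L := CompatibleMatchings.extendSegment D e) (x := v) hne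
      (r := -1) (s := 0) (t := δ / 2) (by norm_num) (by linarith) fun u hu0 hu1 => ?_
    · simpa using this
    · rcases le_total 0 u with hu | hu
      · exact hmem h (hray u hu hu1)
      · refine hsub (hD.segmentUnion_subset ⟨v, w, hvw, ?_⟩)
        have : (v : Plane) + u • ((v : Plane) - w) = v + (-u) • ((w : Plane) - v) := by module
        rw [this]
        exact add_smul_mem_segment (by linarith) (by linarith)
  have hold : ∀ z ∈ D, HasSegmentThrough (CompatibleMatchings.extendSegment D e) z ∨
      ∃ v w : S, M.Adj v w ∧ s(v, w) ∉ l ++ [e] ∧ z = v := by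
    intro z hz
    rcases hD.through z hz with h | ⟨v, w, hvw, hl, rfl⟩
    · exact Or.inl (h.mono hsub)
    · by_cases h : e = s(v, w)
      · exact Or.inl (hend v w h)
      · exact Or.inr ⟨v, w, hvw, by simp [hl, Ne.symm h], rfl⟩
  refine ⟨?_, hD.segmentUnion_subset.trans hsub, ?_, ?_, ?_⟩
  · refine hD.isClosed.union ?_
    have : {p | ∃ v w : S, e = s(v, w) ∧ p ∈ blockedRay D v w} =
        ⋃ v : S, ⋃ w : S, {p | e = s(v, w) ∧ p ∈ blockedRay D v w} := by
      ext p; simp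
    rw [this]
    refine isClosed_iUnion_of_finite fun v => isClosed_iUnion_of_finite fun w => ?_
    by_cases h : e = s(v, w)
    · exact isClosed_const.inter (isClosed_blockedRay _ fun h' => (hadj h).ne (Subtype.ext h'))
    · simp [h]
  · intro v w hvw
    by_cases h : e = s(v, w)
    · filter_upwards [hD.near_line v w hvw] with p hp hpe
      rcases hpe with hpD | ⟨a, b, hab, hpab⟩
      · exact hp hpD
      · have := cross_eq_zero_of_mem_blockedRay hpab
        rcases Sym2.eq_iff.1 (hab.symm.trans h) with ⟨rfl, rfl⟩ | ⟨rfl, rfl⟩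
        · exact this
        · simp only [cross, PiLp.sub_apply] at this ⊢
          linarith
    · filter_upwards [hD.near_line v w hvw, hoff v w hvw h] with p hp hpo hpe using hp (hpo hpe)
  · intro v w hvw hl
    simp only [List.mem_append, List.mem_singleton, not_or] at hl
    filter_upwards [hD.near_segment v w hvw hl.1, hoff v w hvw (Ne.symm hl.2)] with p hp hpo hpe
      using hp (hpo hpe)
  · rintro z (hz | ⟨v, w, h, t, ht0, ht, rfl⟩)
    · exact hold z hz
    have hne : (v : Plane) - w ≠ 0 := sub_ne_zero.2 fun h' => (hadj h).ne (Subtype.ext h')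
    rcases ht0.eq_or_lt with rfl | ht0
    · simpa using Or.inl (hend v w h)
    by_cases hzD : (v : Plane) + t • ((v : Plane) - w) ∈ D
    · exact hold _ hzD
    left
    have hcont : Continuous fun u : ℝ => (v : Plane) + u • ((v : Plane) - w) := by fun_prop
    -- A point of the ray outside the closed set `D` is not where the ray stops: the ray continues
    -- beyond it.
    obtain ⟨ε, hε, hball⟩ := Metric.isOpen_iff.1 (hD.isClosed.isOpen_compl.preimage hcont) t hzD
    refine hasSegmentThrough_of_Icc hne ht0 (t := t + ε / 2) (by linarith) fun u hu0 hu1 =>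
      hmem h ⟨u, hu0, fun r hr0 hru => ?_, rfl⟩
    rcases lt_or_ge r t with hrt | hrt
    · exact ht r hr0 hrt
    · exact hball (by rw [Metric.mem_ball, Real.dist_eq, abs_of_nonneg] <;> linarith)

lemma isPartialExtension_foldl (hS : GeneralPosition S) (hM : ∀ v, ∃! w, M.Adj v w)
    (l : List (Sym2 S)) (hl : l.Nodup) (hlM : ∀ e ∈ l, e ∈ M.edgeSet) :
    IsPartialExtension M l (l.foldl extendSegment (segmentUnion M)) := by
  induction l using List.reverseRecOn with
  | nil => exact isPartialExtension_segmentUnion hS hM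
  | append_singleton l e ih =>
    rw [List.foldl_append]
    rw [List.nodup_append] at hl
    refine (ih hl.1 fun f hf => hlM f (by simp [hf])).extendSegment hS hM (hlM e (by simp)) ?_
    exact fun he => hl.2.2 e he e (by simp) rfl

/-- The geometric properties of an extension. -/
lemma IsExtension.properties (hS : GeneralPosition S) (hM : ∀ v, ∃! w, M.Adj v w) {L : Set Plane}
    (h : IsExtension M L) : IsClosed L ∧ segmentUnion M ⊆ L ∧ (∀ z ∈ L, HasSegmentThrough L z) ∧
      ∀ v w : S, M.Adj v w →
        ∀ᶠ p in 𝓝 (v : Plane), p ∈ L → cross (p - v) ((w : Plane) - v) = 0 := by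
  obtain ⟨l, hl, hmem, rfl⟩ := h
  have := isPartialExtension_foldl hS hM l hl fun e he => (hmem e).1 he
  refine ⟨this.isClosed, this.segmentUnion_subset, fun z hz => ?_, this.near_line⟩
  refine (this.through z hz).resolve_right ?_
  rintro ⟨v, w, hvw, hn, -⟩
  exact hn ((hmem _).2 hvw)

end Extensions

/-! ### Pairings of minimal cost -/

section Involutions

variable {X γ : Type*}

lemma exists_involution_of_even_card [Finite X] (h : Even (Nat.card X)) :
    ∃ τ : Equiv.Perm X, (∀ x, τ (τ x) = x) ∧ ∀ x, τ x ≠ x := by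
  obtain ⟨k, hk⟩ := h
  let e : X ≃ Fin k ⊕ Fin k := (Finite.equivFinOfCardEq hk).trans finSumFinEquiv.symm
  refine ⟨(e.trans (Equiv.sumComm _ _)).trans e.symm, fun x => by simp, fun x hx => ?_⟩
  have : (e x).swap = e x := by
    have := congrArg e hx
    simpa using this
  rcases h : e x with i | i <;> simp [h] at this

lemma exists_involution_of_even_fibers [Finite X] (f : X → γ)
    (h : ∀ c, Even (f ⁻¹' {c}).ncard) :
    ∃ σ : Equiv.Perm X, (∀ x, σ (σ x) = x) ∧ (∀ x, σ x ≠ x) ∧ ∀ x, f (σ x) = f x := by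
  have h' : ∀ c, ∃ τ : Equiv.Perm {x // f x = c}, (∀ x, τ (τ x) = x) ∧ ∀ x, τ x ≠ x :=
    fun c => exists_involution_of_even_card (h c)
  choose τ hτ hτ' using h'
  refine ⟨(Equiv.sigmaFiberEquiv f).permCongr (Equiv.sigmaCongrRight τ), fun x => ?_, fun x => ?_,
    fun x => ?_⟩
  · have hfib : ∀ c (y : {x // f x = c}), (τ (f y.1) ⟨y.1, rfl⟩ : X) = τ c y := by
      rintro _ ⟨y, rfl⟩
      rfl
    simp only [Equiv.permCongr_apply, Equiv.sigmaFiberEquiv]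
    exact (hfib _ _).trans (congrArg Subtype.val (hτ (f x) ⟨x, rfl⟩))
  · simp only [Equiv.permCongr_apply, Equiv.sigmaFiberEquiv]
    exact fun hx => hτ' (f x) ⟨x, rfl⟩ (Subtype.ext hx)
  · exact (τ (f x) ⟨x, rfl⟩).2

/-- A cheapest way of pairing the elements within each fiber of `f` is not improved by exchanging
partners between two pairs. -/
lemma exists_optimal_involution [Fintype X] (f : X → γ) (h : ∀ c, Even (f ⁻¹' {c}).ncard)
    (cost : X → X → ℝ) (hcost : ∀ x y, cost x y = cost y x) :
    ∃ σ : Equiv.Perm X, (∀ x, σ (σ x) = x) ∧ (∀ x, σ x ≠ x) ∧ (∀ x, f (σ x) = f x) ∧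
      ∀ a c, c ≠ a → c ≠ σ a → f c = f a →
        cost a (σ a) + cost c (σ c) ≤ cost a c + cost (σ a) (σ c) := by
  classical
  obtain ⟨σ, ⟨h₁, h₂, h₃⟩, hmin⟩ := Set.exists_min_image
    {σ : Equiv.Perm X | (∀ x, σ (σ x) = x) ∧ (∀ x, σ x ≠ x) ∧ ∀ x, f (σ x) = f x}
    (fun σ => ∑ x, cost x (σ x)) (Set.toFinite _) (exists_involution_of_even_fibers f h)
  refine ⟨σ, h₁, h₂, h₃, fun a c hca hcb hf => ?_⟩
  -- Conjugation by this transposition replaces the pairs `{a, σ a}`, `{c, σ c}` by `{a, c}`, `{σ a,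
  -- σ c}` and keeps the others.
  let ρ := Equiv.swap (σ a) c
  have hρ : ∀ x, ρ (ρ x) = x := fun x => Equiv.swap_apply_self _ _ x
  have hfρ : ∀ x, f (ρ x) = f x := by
    intro x
    simp only [ρ, Equiv.swap_apply_def]
    split_ifs with h h
    · rw [h, h₃, hf]
    · rw [h, h₃, hf]
    · rfl
  have hmin' := hmin (ρ * σ * ρ) ⟨fun x => by simp [hρ, h₁], fun x hx => ?_, fun x => by
    simp [hfρ, h₃]⟩
  · have hda : σ c ≠ a := fun h => hcb (by rw [← h, h₁])
    have hdb : σ c ≠ σ a := fun h => hca (σ.injective h)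
    have hva : (ρ * σ * ρ) a = c := by
      simp [ρ, Equiv.swap_apply_of_ne_of_ne (h₂ a).symm hca.symm]
    have hvb : (ρ * σ * ρ) (σ a) = σ c := by
      simp [ρ, Equiv.swap_apply_of_ne_of_ne hdb (h₂ c)]
    have hvc : (ρ * σ * ρ) c = a := by
      simp [ρ, h₁, Equiv.swap_apply_of_ne_of_ne (h₂ a).symm hca.symm]
    have hvd : (ρ * σ * ρ) (σ c) = σ a := by
      simp [ρ, h₁, Equiv.swap_apply_of_ne_of_ne hdb (h₂ c)]
    have hother : ∀ x, x ≠ a → x ≠ σ a → x ≠ c → x ≠ σ c → (ρ * σ * ρ) x = σ x := by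
      intro x hxa hxb hxc hxd
      simp only [Equiv.Perm.mul_apply, ρ]
      rw [Equiv.swap_apply_of_ne_of_ne hxb hxc, Equiv.swap_apply_of_ne_of_ne]
      · exact fun h => hxa (σ.injective h)
      · exact fun h => hxd (by rw [← h, h₁])
    -- Only four terms of the sum change; each pair is counted from both ends, so the inequality
    -- appears doubled.
    rw [← sub_nonneg, ← Finset.sum_sub_distrib,
      ← Finset.sum_subset (Finset.subset_univ {a, σ a, c, σ c}) fun x _ hx => ?_] at hmin'
    · rw [Finset.sum_insert (by simp [(h₂ a).symm, hca.symm, hda.symm]),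
        Finset.sum_insert (by simp [hcb.symm, hdb.symm]), Finset.sum_insert (by simp [(h₂ c).symm]),
        Finset.sum_singleton, hva, hvb, hvc, hvd, h₁, h₁, hcost c a, hcost (σ c) (σ a),
        hcost (σ a) a, hcost (σ c) c] at hmin'
      linarith
    · simp only [Finset.mem_insert, Finset.mem_singleton, not_or] at hx
      rw [hother x hx.1 hx.2.1 hx.2.2.1 hx.2.2.2, sub_self]
  · simp only [Equiv.Perm.mul_apply] at hx
    exact h₂ (ρ x) (by rw [← hρ (σ (ρ x)), hx])

end Involutions

/-! ### The disjoint compatible matching -/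

section CompatibleMatching

variable {S : Finset Plane} {M : SimpleGraph S}

lemma cross_comm_eq_zero {u w : Plane} (h : cross u w = 0) : cross w u = 0 := by
  simp only [cross] at *
  linarith

/-- Exchanging the partners of two crossing segments decreases the total length. -/
lemma dist_add_dist_lt_of_crossing (hS : GeneralPosition S) {a b c d : S} (hab : a ≠ b)
    (hac : a ≠ c) (had : a ≠ d) (hbc : b ≠ c) (hcd : c ≠ d) {p : Plane}
    (hp : p ∈ segment ℝ (a : Plane) b) (hp' : p ∈ segment ℝ (c : Plane) d) :
    dist a c + dist b d < dist a b + dist c d := by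
  have h₁ := dist_add_dist_of_mem_segment hp
  have h₂ := dist_add_dist_of_mem_segment hp'
  -- Equality would put `p` on `ac`. Then either `p = a` lies on `cd`, or `ab` and `ac` share a
  -- line; both contradict general position.
  have h₃ : dist (a : Plane) c < dist (a : Plane) p + dist p c := by
    refine lt_of_le_of_ne (dist_triangle _ _ _) fun h => ?_
    have h₄ := cross_eq_zero_of_mem_segment (dist_add_dist_eq_iff.1 h.symm).mem_segment
    have h₅ := cross_eq_zero_of_mem_segment hp
    by_cases hpa : p = a
    · subst hpa
      rcases hS.eq_or_eq hcd (cross_eq_zero_of_mem_segment hp') with h | h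
      · exact hac h
      · exact had h
    · have hne := sub_ne_zero.2 hpa
      obtain ⟨r, hr⟩ := exists_eq_smul_of_cross_eq_zero hne (cross_comm_eq_zero h₄)
      obtain ⟨s, hs⟩ := exists_eq_smul_of_cross_eq_zero hne (cross_comm_eq_zero h₅)
      have : cross ((c : Plane) - a) ((b : Plane) - a) = 0 := by
        rw [hr, hs]
        simp only [cross, PiLp.smul_apply, smul_eq_mul]
        ring
      rcases hS.eq_or_eq hab this with h | h
      · exact hac h.symm
      · exact hbc h.symm
  have h₆ := dist_triangle (b : Plane) p d
  rw [dist_comm (b : Plane) p] at h₆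
  rw [dist_comm (c : Plane) p] at h₂
  simp only [Subtype.dist_eq]
  linarith

theorem HasEvenlyOrientedExtension.hasDisjointCompatibleMatching (hS : GeneralPosition S)
    (hM : IsPerfectMatching M) (h : HasEvenlyOrientedExtension M) :
    HasDisjointCompatibleMatching M := by
  classical
  obtain ⟨L, hext, head, ⟨hor, heven⟩, htwo⟩ := h
  obtain ⟨hcl, hsub, hthrough, hloc⟩ := hext.properties hS hM.2
  have hSL : ∀ v : S, (v : Plane) ∈ L := fun v =>
    let ⟨w, hvw, _⟩ := hM.2 v
    hsub ⟨v, w, hvw, left_mem_segment ℝ _ _⟩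
  have hedge : ∀ v : S, v ∈ (dualMultigraph S L).edgeSet := by
    intro v
    obtain ⟨w, hvw, -⟩ := hM.2 v
    obtain ⟨C, D, hCD, hset⟩ := exists_cells_eq_pair hcl hthrough
      (sub_ne_zero.2 fun h => hvw.ne (Subtype.ext h.symm)) (hSL v) (hloc v w hvw)
    exact Graph.IsLink.edge_mem (G := dualMultigraph S L) (e := v) (x := C) (y := D) ⟨hCD, hset⟩
  have hhead : ∀ v : S, head v ∈ cells L ∧ (v : Plane) ∈ frontier (head v) := by
    intro v
    obtain ⟨D, -, hD⟩ := hor v (hedge v)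
    have : head v ∈ ({head v, D} : Set (Set Plane)) := Set.mem_insert _ _
    rwa [← hD] at this
  have hinc : ∀ C, incoming (dualMultigraph S L) head C = head ⁻¹' {C} := by
    intro C
    ext v
    simp [incoming, hedge]
  have hfib : ∀ C, Even (head ⁻¹' {C}).ncard := by
    intro C
    by_cases hC : C ∈ cells L
    · exact hinc C ▸ heven C hC
    · have : head ⁻¹' {C} = ∅ := by
        ext v
        simp only [Set.mem_preimage, Set.mem_singleton_iff, Set.mem_empty_iff_false, iff_false]
        rintro rfl
        exact hC (hhead v).1
      simp [this]
  obtain ⟨B, hB⟩ := Metric.isBounded_iff.1 S.finite_toSet.isBounded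
  have hB : ∀ v w : S, dist v w ≤ B := fun v w => hB v.2 w.2
  -- The penalty `2 * B + 1` exceeds the total length of any two segments.
  let cost : S → S → ℝ := fun v w => dist v w + if M.Adj v w then 2 * B + 1 else 0
  have hcost_of_not : ∀ {v w}, ¬ M.Adj v w → cost v w = dist v w := fun h => by simp [cost, h]
  have hcost_le : ∀ v w, dist v w ≤ cost v w := by
    intro v w
    have := dist_nonneg.trans (hB v w)
    simp only [cost]
    split_ifs <;> linarith
  obtain ⟨σ, hinv, hfix, hcell, hopt⟩ := exists_optimal_involution head hfib cost fun v w => by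
    simp only [cost, dist_comm v w, M.adj_comm v w]
  have hdisj : ∀ v, ¬ M.Adj v (σ v) := by
    intro a ha
    -- Otherwise the cell has indegree 2 and its incoming edges are the endpoints of one segment.
    -- With a further point `c`, the exchange gives two pairs outside `M`, as `a` and `σ a` are
    -- matched to each other in `M`, and saves the penalty.
    obtain ⟨c, hc, hca, hcb⟩ : ∃ c, head c = head a ∧ c ≠ a ∧ c ≠ σ a := by
      by_contra! hno
      have hpair : incoming (dualMultigraph S L) head (head a) = {a, σ a} := by
        rw [hinc]
        ext c
        simp only [Set.mem_preimage, Set.mem_singleton_iff, Set.mem_insert_iff]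
        constructor
        · intro h
          by_contra! hne
          exact hne.2 (hno c h hne.1)
        · rintro (rfl | rfl)
          · rfl
          · exact hcell a
      refine htwo _ (hhead a).1 ?_ a ?_ (σ a) ?_ ha <;> rw [hpair]
      · exact Set.ncard_pair (hfix a).symm
      · simp
      · simp
    have h₁ := hopt a c hca hcb hc
    have hac : ¬ M.Adj a c := fun h => hcb ((hM.2 a).unique h ha)
    have hbd : ¬ M.Adj (σ a) (σ c) := fun h =>
      hcb (by rw [← (hM.2 (σ a)).unique h ha.symm, hinv])
    rw [hcost_of_not hac, hcost_of_not hbd] at h₁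
    have h₂ : cost a (σ a) = dist a (σ a) + (2 * B + 1) := by simp [cost, ha]
    have h₃ := (dist_nonneg).trans (hcost_le c (σ c))
    have h₄ := dist_nonneg (x := a) (y := σ a)
    linarith [hB a c, hB (σ a) (σ c)]
  have hopen : ∀ v : S, openSegment ℝ (v : Plane) (σ v) ⊆ head v := by
    intro v
    obtain ⟨w, hvw, -⟩ := hM.2 v
    refine openSegment_subset_of_mem_cells hcl hthrough (hhead v).1
      (frontier_subset_closure (hhead v).2) ?_ (hloc v w hvw) fun h => ?_
    · have := frontier_subset_closure (hhead (σ v)).2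
      rwa [hcell] at this
    · rcases hS.eq_or_eq hvw.ne h with h | h
      · exact hfix v h
      · exact hdisj v (h ▸ hvw)
  have hseg : ∀ v : S, ∀ p ∈ segment ℝ (v : Plane) (σ v),
      p ∈ ({(v : Plane), ↑(σ v)} : Set Plane) ∨ p ∈ head v := by
    intro v p hp
    rw [← insert_endpoints_openSegment] at hp
    rcases hp with rfl | rfl | hp
    · simp
    · simp
    · exact Or.inr (hopen v hp)
  have hpairL : ∀ v : S, ∀ p ∈ ({(v : Plane), ↑(σ v)} : Set Plane), p ∈ L := by
    rintro v p (rfl | rfl) <;> exact hSL _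
  have hmixed : ∀ a b c : S, M.Adj a b → segment ℝ (a : Plane) b ∩ segment ℝ (c : Plane) (σ c) ⊆
      {(a : Plane), ↑b} ∩ {(c : Plane), ↑(σ c)} := by
    rintro a b c hab p ⟨hp, hp'⟩
    have hpL : p ∈ L := hsub ⟨a, b, hab, hp⟩
    have hpc := (hseg c p hp').resolve_right fun h =>
      subset_compl_of_mem_cells (hhead c).1 h hpL
    refine ⟨?_, hpc⟩
    obtain ⟨x, rfl⟩ : ∃ x : S, p = x := by
      rcases hpc with rfl | rfl
      · exact ⟨_, rfl⟩
      · exact ⟨_, rfl⟩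
    rcases hS.eq_or_eq hab.ne (cross_eq_zero_of_mem_segment hp) with rfl | rfl <;> simp
  have hnew : ∀ a c : S, c ≠ a → c ≠ σ a → segment ℝ (a : Plane) (σ a) ∩
      segment ℝ (c : Plane) (σ c) ⊆ {(a : Plane), ↑(σ a)} ∩ {(c : Plane), ↑(σ c)} := by
    rintro a c hca hcb p ⟨hp, hp'⟩
    have hdb : σ c ≠ σ a := fun h => hca (σ.injective h)
    have hda : σ c ≠ a := fun h => hcb (by rw [← h, hinv])
    by_cases hc : head c = head a
    · exfalso
      have h₁ := hopt a c hca hcb hc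
      -- Two crossing segments can be exchanged in two ways, both of which shorten the total length.
      have h₂ := hopt a (σ c) hda hdb (by rw [hcell, hc])
      have h₃ := dist_add_dist_lt_of_crossing hS (hfix a).symm hca.symm hda.symm hcb.symm
        (hfix c).symm hp hp'
      rw [segment_symm] at hp'
      have h₄ := dist_add_dist_lt_of_crossing hS (hfix a).symm hda.symm hca.symm hdb.symm
        (hfix c) hp hp'
      rw [hinv, hcost_of_not (hdisj a), hcost_of_not fun h => hdisj c h.symm] at h₂
      rw [hcost_of_not (hdisj a), hcost_of_not (hdisj c)] at h₁
      -- If one exchange uses a segment of `M`, the other uses none, since `M` is a matching; so one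
      -- of the two avoids the penalty and contradicts optimality.
      by_cases hadj : M.Adj a c ∨ M.Adj (σ a) (σ c)
      · have hn₁ : ¬ M.Adj a (σ c) := by
          rcases hadj with h | h
          · exact fun h' => hfix c ((hM.2 a).unique h' h)
          · exact fun h' => hfix a ((hM.2 (σ c)).unique h.symm h'.symm)
        have hn₂ : ¬ M.Adj (σ a) c := by
          rcases hadj with h | h
          · exact fun h' => hfix a ((hM.2 c).unique h'.symm h.symm)
          · exact fun h' => hfix c ((hM.2 (σ a)).unique h h')
        rw [hcost_of_not hn₁, hcost_of_not hn₂] at h₂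
        linarith
      · rw [not_or] at hadj
        rw [hcost_of_not hadj.1, hcost_of_not hadj.2] at h₁
        linarith
    · have hout : ∀ v, p ∈ L → p ∉ head v := fun v hpL h =>
        subset_compl_of_mem_cells (hhead v).1 h hpL
      rcases hseg a p hp with h | h <;> rcases hseg c p hp' with h' | h'
      · exact ⟨h, h'⟩
      · exact (hout c (hpairL a p h) h').elim
      · exact (hout a (hpairL c p h') h).elim
      · exact (hc (eq_of_mem_cells (hhead c).1 (hhead a).1 h' h)).elim
  let M' : SimpleGraph S :=
    { Adj := fun v w => σ v = w
      symm := ⟨fun v w h => by rw [← h, hinv]⟩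
      loopless := ⟨fun v => hfix v⟩ }
  have hunion : NonCrossing (M ⊔ M') := by
    rintro a b c d (hab | hab) (hcd | hcd) hne
    · exact hM.1 a b c d hab hcd hne
    · obtain rfl : σ c = d := hcd
      exact hmixed a b c hab
    · obtain rfl : σ a = b := hab
      rw [Set.inter_comm, Set.inter_comm {(a : Plane), _}]
      exact hmixed c d a hcd
    · obtain rfl : σ a = b := hab
      obtain rfl : σ c = d := hcd
      refine hnew a c (fun h => hne (by rw [h])) fun h => hne ?_
      rw [h, hinv, Sym2.eq_swap]
  have hM' : NonCrossing M' := fun a b c d hab hcd => hunion a b c d (Or.inr hab) (Or.inr hcd)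
  refine ⟨M', ⟨hM', fun v => ⟨σ v, rfl, fun w hw => Eq.symm hw⟩⟩, ?_, hM.1, hM', hunion⟩
  rw [Set.disjoint_left]
  intro e
  induction e with
  | _ a b =>
  intro hab hab'
  obtain rfl : σ a = b := hab'
  exact hdisj a hab

end CompatibleMatching

end CompatibleMatchings

theorem mainTheorem4 :
    -- the chain of implications between the conjectures
    ((CompatibleMatchings.TwoTreesConjecture → CompatibleMatchings.TwoSubgraphsConjecture) ∧
      (CompatibleMatchings.TwoSubgraphsConjecture → CompatibleMatchings.ExtensionConjecture) ∧
      (CompatibleMatchings.ExtensionConjecture →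
        CompatibleMatchings.CompatibleMatchingConjecture)) ∧
    -- each implication holds for every single perfect matching
    (∀ (S : Finset CompatibleMatchings.Plane) (M : SimpleGraph S),
      CompatibleMatchings.GeneralPosition S → CompatibleMatchings.IsPerfectMatching M →
      (CompatibleMatchings.IsEvenMatching M → CompatibleMatchings.HasTwoTreesExtension M →
        CompatibleMatchings.HasTwoSubgraphsExtension M) ∧
      (CompatibleMatchings.HasTwoSubgraphsExtension M →
        CompatibleMatchings.HasEvenlyOrientedExtension M) ∧
      (CompatibleMatchings.HasEvenlyOrientedExtension M →
        CompatibleMatchings.HasDisjointCompatibleMatching M)) := by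
  refine ⟨⟨fun h S M hS hM he => ?_, fun h S M hS hM he => ?_, fun h S M hS hM he => ?_⟩,
    fun S M hS hM => ⟨fun he h => h.hasTwoSubgraphsExtension hM he,
      fun h => h.hasEvenlyOrientedExtension, fun h => h.hasDisjointCompatibleMatching hS hM⟩⟩
  · exact (h S M hS hM).hasTwoSubgraphsExtension hM he
  · exact (h S M hS hM he).hasEvenlyOrientedExtension
  · exact (h S M hS hM he).hasDisjointCompatibleMatching hS hM
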